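/- Let $\Gamma$ be a simple graph on the vertex set $[n]=\{1,\dots,n\}$. For a vertex $v$ and an integer $t\ge 0$ let $Q_v^t$ be the distribution after $t$ steps of the random walk on $\Gamma$ started at $v$ (in each step the walk moves to a uniformly random neighbour of the current vertex), let $U$ be the uniform distribution on $[n]$, and let $\|P_1-P_2\|=\frac12\sum_{j\in[n]}|P_1(j)-P_2(j)|$ be the total variation distance. A $K_h$-minor of depth $d$ in $\Gamma$ consists of $h$ pairwise disjoint nonempty vertex sets $B_1,\dots,B_h$ such that each induced subgraph $\Gamma[B_i]$ is connected with radius at most $d$, and $\Gamma$ has an edge between $B_i$ and $B_j$ for all $i\ne j$. There are absolute constants $c,C>0$ such that the following holds. Let $\epsilon,\delta$ be real numbers with $0<\epsilon<\frac25$ and $0<\delta\le\frac1{30}$, and let $n\ge 2$, $D\ge 0$ and $\tau\ge 0$ be integers. Suppose that $\Gamma$ is a $D$-regular simple graph on $[n]$ such that $\|Q_v^\tau-U\|<\delta$ for at least $\epsilon n$ vertices $v\in[n]$ (this forces $D\ge 1$ and $\tau\ge 1$). Then, for some integers $h$ and $d$ with $$h\ \ge\ c\,\frac{\epsilon}{\tau}\sqrt{\frac{n}{\log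 n}}\qquad\text{and}\qquad d\ \le\ C\,\frac{\tau}{\epsilon}\log n,$$ $\Gamma$ contains a $K_h$-minor of depth $d$. That is, $\Gamma$ has a shallow clique minor, of depth $O\big(\frac{\tau}{\epsilon}\log n\big)$ and order $\Omega\big(\frac{\epsilon}{\tau}\sqrt{n/\log n}\big)$. -/

import Mathlib

namespace WellMixing

/-- Transition matrix of the nearest neighbour random walk on `G`: from `u` the walk moves to a
uniformly random neighbour of `u`. -/
noncomputable def transitionMatrix {V : Type*} [Fintype V] (G : SimpleGraph V)
    [DecidableRel G.Adj] : Matrix V V ℝ :=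
  Matrix.of fun u v => if G.Adj u v then (1 : ℝ) / (G.degree u : ℝ) else 0

/-- `walkDist G t v j` is the probability that the random walk on `G` started at `v`
is at `j` after `t` steps. -/
noncomputable def walkDist {V : Type*} [Fintype V] [DecidableEq V] (G : SimpleGraph V)
    [DecidableRel G.Adj] (t : ℕ) (v : V) : V → ℝ :=
  fun j => (transitionMatrix G ^ t) v j

/-- The uniform distribution on `V`. -/
noncomputable def uniformDist (V : Type*) [Fintype V] : V → ℝ :=
  fun _ => 1 / (Fintype.card V : ℝ)

/-- Total variation distance of two probability distributions on a finite set. -/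
noncomputable def tvDist {V : Type*} [Fintype V] (P Q : V → ℝ) : ℝ :=
  (1 / 2) * ∑ j, |P j - Q j|

/-- `H` is a depth-`d` (shallow) minor of `G`: there are pairwise disjoint branch sets `B i`, one
for each vertex `i` of `H`, such that each `B i` has a centre from which every vertex of `B i` is
reached by a walk of length at most `d` inside `B i` (so `B i` is nonempty and induces a connected
subgraph of radius at most `d`), and adjacent vertices of `H` have branch sets joined by an edge
of `G`. -/
def IsShallowMinor {W V : Type*} (H : SimpleGraph W) (G : SimpleGraph V) (d : ℕ) : Prop :=
  ∃ B : W → Set V,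
    (∀ i j, i ≠ j → Disjoint (B i) (B j)) ∧
    (∀ i, ∃ x ∈ B i, ∀ y ∈ B i, ∃ p : G.Walk x y, p.length ≤ d ∧ ∀ z ∈ p.support, z ∈ B i) ∧
    (∀ i j, H.Adj i j → ∃ x ∈ B i, ∃ y ∈ B j, G.Adj x y)

end WellMixing

/-!
The proof combines two facts about separators.

* A graph in which many vertices mix well has no small balanced separator
  (`not_balanced_of_mixing`).  Let `Z` separate `A` from `B`.  A walk started in `A` can only leave
  `A` through `Z`, so it is still in `A` at time `τ` unless it has visited `Z`.  Averaged over the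
  starting vertex, the expected number of visits to `Z` in `τ` steps is at most `τ |Z| / n`, because
  the transition matrix of a regular graph has column sums `1`.  If `|Z| ≤ ε n / (5 τ)`,
  then this is too small for a typical one of the `ε n` well-mixing vertices to see the uniform
  distribution, unless `A` or `B` has more than `2 n / 3` vertices.

* A graph without small balanced separators has a shallow clique minor, by the argument of
  Plotkin, Rao and Smith (`isShallowMinor_top_of_no_separator`).  One keeps a set `S` of vertices
  cut off from the remaining vertices `W` by a set `X`, with `|X| ≤ |S| / l`, and by the branch sets
  of a clique minor.  A branch set without neighbours in `W` can be moved to `S`.  Otherwise one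
  looks at balls in the graph induced on `W`: either a ball of radius `2 r` around a vertex of `W`
  contains a neighbour of every branch set, and paths to these neighbours form a new branch set, or
  there are two disjoint balls of radius `r`.  The smaller one has a radius at which its next layer
  is at most a `1 / l` fraction of it, since otherwise it would have more than `n` vertices; so it
  can be moved to `S` and the layer to `X`.  The absence of balanced separators guarantees that `S`
  never grows beyond `n / 3`, so a configuration which is maximal for these moves has enough branch
  sets.

With `l = 10 τ / ε`, `r ≈ 2 l log n` and `h ≈ (ε / τ) √(n / log n) / 60` the separators that occur
have at most `n / l + h ^ 2 (2 r + 1) ≤ ε n / (5 τ)` vertices.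
-/

namespace WellMixing

open Finset

/-! ### Mixing excludes small balanced separators -/

section Mixing

variable {V : Type*} [Fintype V] {G : SimpleGraph V} [DecidableRel G.Adj]

lemma transitionMatrix_nonneg (u v : V) : 0 ≤ transitionMatrix G u v := by
  simp only [transitionMatrix, Matrix.of_apply]
  split_ifs <;> positivity

lemma sum_transitionMatrix_row {D : ℕ} (hG : G.IsRegularOfDegree D) (hD : D ≠ 0) (u : V) :
    ∑ v, transitionMatrix G u v = 1 := by
  have hD' : (D : ℝ) ≠ 0 := by exact_mod_cast hD
  have hc : #{v | G.Adj u v} = D := by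
    rw [← hG u, ← SimpleGraph.card_neighborFinset_eq_degree]
    congr 1
    ext v
    simp
  simp only [transitionMatrix, Matrix.of_apply, ← Finset.sum_filter, Finset.sum_const, hc, hG u]
  simp [hD']

lemma sum_transitionMatrix_col {D : ℕ} (hG : G.IsRegularOfDegree D) (hD : D ≠ 0) (v : V) :
    ∑ u, transitionMatrix G u v = 1 := by
  rw [← sum_transitionMatrix_row hG hD v]
  refine Finset.sum_congr rfl fun u _ => ?_
  simp [transitionMatrix, G.adj_comm u v, hG u, hG v]

/-- For probability distributions the factor `2` is superfluous; this version needs no hypotheses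
and suffices here. -/
lemma sum_sub_le_two_mul_tvDist (P Q : V → ℝ) (A : Finset V) :
    ∑ j ∈ A, P j - ∑ j ∈ A, Q j ≤ 2 * tvDist P Q := by
  rw [← Finset.sum_sub_distrib, tvDist, ← mul_assoc, mul_one_div_cancel two_ne_zero, one_mul]
  calc ∑ j ∈ A, (P j - Q j) ≤ ∑ j ∈ A, |P j - Q j| := Finset.sum_le_sum fun _ _ => le_abs_self _
    _ ≤ ∑ j, |P j - Q j| :=
      Finset.sum_le_sum_of_subset_of_nonneg (subset_univ A) fun _ _ _ => abs_nonneg _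

variable [DecidableEq V]

lemma sum_walkDist_succ (A : Finset V) (t : ℕ) (v : V) :
    ∑ j ∈ A, walkDist G (t + 1) v j
      = ∑ u, transitionMatrix G v u * ∑ j ∈ A, walkDist G t u j := by
  simp only [walkDist, pow_succ', Matrix.mul_apply, Finset.mul_sum]
  exact Finset.sum_comm

/-- The function `q` is the expected number of visits to `Z` during steps `1, …, t` of the walk, as
a function of the starting vertex.  A walk that starts in a set `A` whose outer boundary lies in `Z`
is still in `A` at time `t` unless it visits `Z`. -/
lemma exists_expected_visits {D : ℕ} (hG : G.IsRegularOfDegree D) (hD : D ≠ 0) (Z : Finset V)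
    (t : ℕ) :
    ∃ q : V → ℝ, (∀ v, 0 ≤ q v) ∧ ∑ v, q v = t * #Z ∧
      ∀ A : Finset V, (∀ u ∈ A, ∀ v, G.Adj u v → v ∈ A ∨ v ∈ Z) →
        ∀ v ∈ A, 1 - q v ≤ ∑ j ∈ A, walkDist G t v j := by
  suffices H : ∃ q : V → ℝ, (∀ v, 0 ≤ q v) ∧ ∑ v, q v = t * #Z ∧
      ∀ A : Finset V, (∀ u ∈ A, ∀ v, G.Adj u v → v ∈ A ∨ v ∈ Z) →
        ∀ v, (if v ∈ A then 1 else 0) - q v ≤ ∑ j ∈ A, walkDist G t v j by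
    obtain ⟨q, h0, h1, h2⟩ := H
    exact ⟨q, h0, h1, fun A hA v hv => by simpa [hv] using h2 A hA v⟩
  induction t with
  | zero =>
    refine ⟨fun _ => 0, by simp, by simp, fun A _ v => ?_⟩
    simp [walkDist, Matrix.one_apply]
  | succ t ih =>
    obtain ⟨q, h0, h1, h2⟩ := ih
    refine ⟨fun v => ∑ u, transitionMatrix G v u * ((if u ∈ Z then 1 else 0) + q u),
      fun v => ?_, ?_, fun A hA v => ?_⟩
    · refine Finset.sum_nonneg fun u _ => mul_nonneg (transitionMatrix_nonneg _ _) ?_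
      have := h0 u
      split_ifs <;> linarith
    · rw [Finset.sum_comm]
      simp only [← Finset.sum_mul, sum_transitionMatrix_col hG hD, one_mul, Finset.sum_add_distrib,
        h1]
      simp
      ring
    · rw [sum_walkDist_succ]
      have hstep : (if v ∈ A then (1 : ℝ) else 0) ≤
          ∑ u, transitionMatrix G v u * ((if u ∈ A then 1 else 0) + (if u ∈ Z then 1 else 0)) := by
        split_ifs with hv
        · refine (sum_transitionMatrix_row hG hD v).symm.trans_le
            (Finset.sum_le_sum fun u _ => ?_)
          by_cases hvu : G.Adj v u
          · refine le_mul_of_one_le_right (transitionMatrix_nonneg _ _) ?_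
            rcases hA v hv u hvu with h | h <;> simp only [h, if_true] <;> split_ifs <;> norm_num
          · simp [transitionMatrix, hvu]
        · refine Finset.sum_nonneg fun u _ => mul_nonneg (transitionMatrix_nonneg _ _) ?_
          split_ifs <;> norm_num
      have hmono : ∑ u, transitionMatrix G v u * ((if u ∈ A then 1 else 0) - q u)
          ≤ ∑ u, transitionMatrix G v u * ∑ j ∈ A, walkDist G t u j :=
        Finset.sum_le_sum fun u _ =>
          mul_le_mul_of_nonneg_left (h2 A hA u) (transitionMatrix_nonneg _ _)
      refine le_trans ?_ hmono
      simp only [mul_add, mul_sub, Finset.sum_add_distrib, Finset.sum_sub_distrib] at hstep ⊢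
      linarith

/-- Without edges the walk has no mass after the first step, so it is at distance `1 / 2` from
the uniform distribution. -/
lemma degree_ne_zero_of_tvDist_lt {D t : ℕ} (hG : G.IsRegularOfDegree D) (ht : t ≠ 0) {v : V}
    (hv : tvDist (walkDist G t v) (uniformDist V) < 1 / 2) : D ≠ 0 := by
  rintro rfl
  have h0 : transitionMatrix G = 0 := by
    ext u w
    simp [transitionMatrix, hG u]
  have hV : (Fintype.card V : ℝ) ≠ 0 := by
    have : Nonempty V := ⟨v⟩
    exact_mod_cast Fintype.card_ne_zero
  simp [tvDist, walkDist, uniformDist, h0, zero_pow ht, hV] at hv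

/-- If at least `ε n` vertices are well mixed after `τ` steps, then there is no separator with
at most `ε n / (5 τ)` vertices which leaves at most `2 n / 3` vertices on either side. -/
lemma not_balanced_of_mixing {ε : ℝ} (hε : 0 < ε) {D τ : ℕ} (hτ : τ ≠ 0) [Nonempty V]
    (hG : G.IsRegularOfDegree D) (S : Finset V) (hS : ε * Fintype.card V ≤ #S)
    (hmix : ∀ v ∈ S, tvDist (walkDist G τ v) (uniformDist V) < 1 / 30)
    (A B : Finset V) (hAB : ∀ u ∈ A, ∀ v ∈ B, ¬ G.Adj u v)
    (hZ : 5 * τ * (#(A ∪ B)ᶜ : ℝ) ≤ ε * Fintype.card V) :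
    2 * Fintype.card V < 3 * #A ∨ 2 * Fintype.card V < 3 * #B := by
  set n := Fintype.card V with hn
  have hn0 : (0 : ℝ) < n := by exact_mod_cast Fintype.card_pos
  have hS0 : (0 : ℝ) < #S := lt_of_lt_of_le (by positivity) hS
  have hD : D ≠ 0 := by
    obtain ⟨v, hv⟩ := Finset.card_pos.mp (by exact_mod_cast hS0)
    exact degree_ne_zero_of_tvDist_lt hG hτ ((hmix v hv).trans (by norm_num))
  obtain ⟨q, q0, qsum, hq⟩ := exists_expected_visits hG hD (A ∪ B)ᶜ τ
  by_contra! hcon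
  -- The constant is `1 - 2 / 3 - 2 * (1 / 30)`.
  have key : ∀ C : Finset V, 3 * #C ≤ 2 * n →
      (∀ u ∈ C, ∀ v, G.Adj u v → v ∈ C ∨ v ∈ (A ∪ B)ᶜ) → ∀ v ∈ S, v ∈ C → 4 / 15 ≤ q v := by
    intro C hC hbd v hvS hvC
    have h1 := hq C hbd v hvC
    have h2 := sum_sub_le_two_mul_tvDist (walkDist G τ v) (uniformDist V) C
    have h3 := hmix v hvS
    have h4 : ∑ j ∈ C, uniformDist V j ≤ 2 / 3 := by
      simp only [uniformDist, Finset.sum_const, nsmul_eq_mul, ← hn]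
      rw [mul_one_div, div_le_iff₀ hn0]
      have : (3 * #C : ℝ) ≤ 2 * n := by exact_mod_cast hC
      linarith
    linarith
  have hlow : ∀ v ∈ S, (4 / 15 : ℝ) * (1 - if v ∈ (A ∪ B)ᶜ then 1 else 0) ≤ q v := by
    intro v hv
    by_cases hvZ : v ∈ (A ∪ B)ᶜ
    · simpa only [hvZ, if_true, sub_self, mul_zero] using q0 v
    · simp only [hvZ, if_false, sub_zero, mul_one]
      have hv' : v ∈ A ∨ v ∈ B := by
        rwa [mem_compl, not_not, mem_union] at hvZ
      rcases hv' with h | h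
      · refine key A hcon.1 (fun u hu w huw => ?_) v hv h
        have := fun hw => hAB u hu w hw huw
        simp only [mem_compl, mem_union]
        tauto
      · refine key B hcon.2 (fun u hu w huw => ?_) v hv h
        have := fun hw => hAB w hw u hu huw.symm
        simp only [mem_compl, mem_union]
        tauto
  have hsum := Finset.sum_le_sum hlow
  rw [← Finset.mul_sum, Finset.sum_sub_distrib] at hsum
  have hle : ∑ v ∈ S, q v ≤ ∑ v, q v :=
    Finset.sum_le_sum_of_subset_of_nonneg (subset_univ S) fun _ _ _ => q0 _
  have hSZ : ∑ v ∈ S, (if v ∈ (A ∪ B)ᶜ then (1 : ℝ) else 0) ≤ #(A ∪ B)ᶜ := by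
    rw [Finset.sum_boole]
    exact_mod_cast Finset.card_le_card fun v hv => (mem_filter.mp hv).2
  have hτ1 : (1 : ℝ) ≤ τ := by exact_mod_cast Nat.one_le_iff_ne_zero.mpr hτ
  have hZ' : (#(A ∪ B)ᶜ : ℝ) ≤ τ * #(A ∪ B)ᶜ := le_mul_of_one_le_left (by positivity) hτ1
  simp only [Finset.sum_const, nsmul_eq_mul, mul_one] at hsum
  rw [qsum] at hle
  linarith

end Mixing

/-! ### Balls in induced subgraphs -/

section Ball

variable {V : Type*} [Fintype V] (G : SimpleGraph V)

open Classical in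
/-- The ball of radius `r` around `x` in the subgraph of `G` induced on `W`; it is empty for
`x ∉ W`. -/
noncomputable def inducedBall (W : Finset V) (x : V) (r : ℕ) : Finset V :=
  {y | ∃ p : G.Walk x y, p.length ≤ r ∧ ∀ z ∈ p.support, z ∈ W}

variable {G} {W : Finset V} {x y z : V} {r s : ℕ}

lemma mem_inducedBall :
    y ∈ inducedBall G W x r ↔ ∃ p : G.Walk x y, p.length ≤ r ∧ ∀ z ∈ p.support, z ∈ W := by
  simp [inducedBall]

lemma inducedBall_subset : inducedBall G W x r ⊆ W := by
  intro y hy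
  obtain ⟨p, -, hp⟩ := mem_inducedBall.mp hy
  exact hp y p.end_mem_support

lemma inducedBall_mono (hrs : r ≤ s) : inducedBall G W x r ⊆ inducedBall G W x s := by
  intro y hy
  obtain ⟨p, hl, hp⟩ := mem_inducedBall.mp hy
  exact mem_inducedBall.mpr ⟨p, hl.trans hrs, hp⟩

lemma self_mem_inducedBall (hx : x ∈ W) : x ∈ inducedBall G W x r :=
  mem_inducedBall.mpr ⟨.nil, by simp, by simpa using hx⟩

lemma mem_inducedBall_add (hy : y ∈ inducedBall G W x r) (hz : z ∈ inducedBall G W y s) :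
    z ∈ inducedBall G W x (r + s) := by
  obtain ⟨p, hl, hp⟩ := mem_inducedBall.mp hy
  obtain ⟨q, hl', hq⟩ := mem_inducedBall.mp hz
  refine mem_inducedBall.mpr ⟨p.append q, by rw [SimpleGraph.Walk.length_append]; omega, ?_⟩
  intro w hw
  rcases SimpleGraph.Walk.mem_support_append_iff _ _ |>.mp hw with h | h
  exacts [hp w h, hq w h]

lemma mem_inducedBall_comm : y ∈ inducedBall G W x r ↔ x ∈ inducedBall G W y r := by
  suffices H : ∀ x y, y ∈ inducedBall G W x r → x ∈ inducedBall G W y r from ⟨H x y, H y x⟩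
  intro x y hy
  obtain ⟨p, hl, hp⟩ := mem_inducedBall.mp hy
  exact mem_inducedBall.mpr ⟨p.reverse, by simpa using hl, by simpa using hp⟩

lemma mem_inducedBall_succ (hy : y ∈ inducedBall G W x r) (hz : z ∈ W) (hyz : G.Adj y z) :
    z ∈ inducedBall G W x (r + 1) :=
  mem_inducedBall_add hy <| mem_inducedBall.mpr
    ⟨hyz.toWalk, by simp, by simpa [hz] using inducedBall_subset hy⟩

variable [DecidableEq V]

/-- Since balls have at most `n` vertices, they cannot grow by a factor `1 + 1 / l` at each of
`r` steps when `n < (1 + 1 / l) ^ r`. -/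
lemma exists_thin_layer {l : ℝ} (hl : 0 < l) (hr : (Fintype.card V : ℝ) < (1 + 1 / l) ^ r)
    (hx : x ∈ W) :
    ∃ s < r, l * #(inducedBall G W x (s + 1) \ inducedBall G W x s) ≤ #(inducedBall G W x s) := by
  by_contra! hcon
  have hgrow : ∀ s ≤ r, (1 + 1 / l) ^ s ≤ (#(inducedBall G W x s) : ℝ) := by
    intro s
    induction s with
    | zero =>
      intro _
      simpa using ⟨x, self_mem_inducedBall (G := G) (r := 0) hx⟩
    | succ s ih =>
      intro hs
      have h1 := ih (by omega)
      have h2 := hcon s (by omega)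
      have h3 : (#(inducedBall G W x (s + 1) \ inducedBall G W x s) : ℝ)
          + #(inducedBall G W x s) = #(inducedBall G W x (s + 1)) := by
        exact_mod_cast Finset.card_sdiff_add_card_eq_card
          (inducedBall_mono (G := G) (W := W) (x := x) (Nat.le_add_right s 1))
      have h4 : (1 / l) * (#(inducedBall G W x s) : ℝ)
          ≤ #(inducedBall G W x (s + 1) \ inducedBall G W x s) := by
        rw [one_div_mul_eq_div, div_le_iff₀' hl]
        exact h2.le
      calc (1 + 1 / l) ^ (s + 1) = (1 + 1 / l) * (1 + 1 / l) ^ s := pow_succ' _ _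
        _ ≤ (1 + 1 / l) * #(inducedBall G W x s) := by gcongr
        _ ≤ _ := by linarith
  have h1 := hgrow r le_rfl
  have h2 : (#(inducedBall G W x r) : ℝ) ≤ Fintype.card V := by exact_mod_cast card_le_univ _
  linarith

/-- Walks from `x` to each of the points `f i`, taken together, form a connected set of small
radius. -/
lemma exists_connected_set {ι : Type*} [DecidableEq ι] (M : Finset ι) (f : ι → V) (hx : x ∈ W)
    (hf : ∀ i ∈ M, f i ∈ inducedBall G W x r) :
    ∃ A ⊆ W, x ∈ A ∧ (∀ i ∈ M, f i ∈ A) ∧ #A ≤ #M * (r + 1) + 1 ∧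
      ∀ y ∈ A, ∃ p : G.Walk x y, p.length ≤ r ∧ ∀ z ∈ p.support, z ∈ A := by
  induction M using Finset.induction_on with
  | empty =>
    refine ⟨{x}, by simpa using hx, by simp, by simp, by simp, fun y hy => ?_⟩
    obtain rfl := mem_singleton.mp hy
    exact ⟨.nil, by simp, by simp⟩
  | insert i M hi ih =>
    obtain ⟨A, hAW, hxA, hfA, hcard, hrad⟩ := ih fun j hj => hf j (mem_insert_of_mem hj)
    obtain ⟨p, hpl, hpW⟩ := mem_inducedBall.mp (hf i (mem_insert_self i M))
    refine ⟨A ∪ p.support.toFinset, ?_, by simp [hxA], ?_, ?_, ?_⟩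
    · exact union_subset hAW fun z hz => hpW z (by simpa using hz)
    · intro j hj
      rcases mem_insert.mp hj with rfl | hj
      · simp
      · simp [hfA j hj]
    · have h1 := card_union_le A p.support.toFinset
      have h2 := p.support.toFinset_card_le
      rw [SimpleGraph.Walk.length_support] at h2
      rw [card_insert_of_notMem hi, Nat.succ_mul]
      omega
    · intro y hy
      rcases mem_union.mp hy with hy | hy
      · obtain ⟨q, hq, hqA⟩ := hrad y hy
        exact ⟨q, hq, fun z hz => mem_union_left _ (hqA z hz)⟩
      · have hy' : y ∈ p.support := by simpa using hy
        refine ⟨p.takeUntil y hy', (p.length_takeUntil_le_length hy').trans hpl, fun z hz => ?_⟩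
        have := p.support_takeUntil_subset_support hy' hz
        simp [this]

end Ball

/-! ### Shallow clique minors in graphs without small separators -/

section Separator

variable {V : Type*} [Fintype V] [DecidableEq V] (G : SimpleGraph V)

/-- The vertices outside `S`, outside `X` and outside all members of `M`. -/
def remaining (S X : Finset V) (M : Finset (Finset V)) : Finset V :=
  (S ∪ X ∪ M.biUnion id)ᶜ

/-- A configuration of the Plotkin–Rao–Smith argument: `M` is the family of branch sets of a clique
minor of depth `d`, each with at most `m` vertices, and `S` is separated from the remaining vertices
by `X` and these branch sets, where `X` is small compared with `S`. -/
structure IsConfig (l : ℝ) (m d : ℕ) (S X : Finset V) (M : Finset (Finset V)) : Prop where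
  card_sep : l * #X ≤ #S
  card_branch : ∀ A ∈ M, #A ≤ m
  radius : ∀ A ∈ M, ∃ x ∈ A, ∀ y ∈ A, ∃ p : G.Walk x y, p.length ≤ d ∧ ∀ z ∈ p.support, z ∈ A
  disjoint : ∀ A ∈ M, ∀ B ∈ M, A ≠ B → Disjoint A B
  adj : ∀ A ∈ M, ∀ B ∈ M, A ≠ B → ∃ x ∈ A, ∃ y ∈ B, G.Adj x y
  disjoint_left : ∀ A ∈ M, Disjoint A S
  not_adj : ∀ u ∈ S, ∀ v ∈ remaining S X M, ¬ G.Adj u v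

variable {G} {l : ℝ} {m d : ℕ} {S X W : Finset V} {M : Finset (Finset V)}

lemma mem_remaining {v : V} :
    v ∈ remaining S X M ↔ v ∉ S ∧ v ∉ X ∧ ∀ A ∈ M, v ∉ A := by
  simp [remaining]

lemma disjoint_remaining {A : Finset V} (hA : A ∈ M) : Disjoint A (remaining S X M) :=
  Finset.disjoint_left.mpr fun _ hv hv' => (mem_remaining.mp hv').2.2 A hA hv

lemma card_separator_le (S X : Finset V) {h : ℕ} (hM : #M ≤ h) (hm : ∀ A ∈ M, #A ≤ m) :
    #(S ∪ remaining S X M)ᶜ ≤ #X + h * m := by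
  have hsub : (S ∪ remaining S X M)ᶜ ⊆ X ∪ M.biUnion id := by
    intro v hv
    simp only [mem_compl, mem_union, mem_remaining, not_or, mem_biUnion, id] at hv ⊢
    by_contra! hcon
    exact hv.2 ⟨hv.1, hcon.1, hcon.2⟩
  calc #(S ∪ remaining S X M)ᶜ ≤ #X + #(M.biUnion id) :=
        (card_le_card hsub).trans (card_union_le _ _)
    _ ≤ #X + #M * m := by gcongr; exact card_biUnion_le_card_mul _ _ _ hm
    _ ≤ #X + h * m := by gcongr

lemma isConfig_empty : IsConfig G l m d ∅ ∅ ∅ where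
  card_sep := by simp
  card_branch := by simp
  radius := by simp
  disjoint := by simp
  adj := by simp
  disjoint_left := by simp
  not_adj := by simp

/-- A branch set without neighbours among the remaining vertices can be given up. -/
lemma IsConfig.move_branch (hc : IsConfig G l m d S X M) {A : Finset V} (hA : A ∈ M)
    (hno : ∀ u ∈ A, ∀ v ∈ remaining S X M, ¬ G.Adj u v) :
    IsConfig G l m d (S ∪ A) X (M.erase A) where
  card_sep := hc.card_sep.trans (by exact_mod_cast card_le_card subset_union_left)
  card_branch B hB := hc.card_branch B (mem_of_mem_erase hB)
  radius B hB := hc.radius B (mem_of_mem_erase hB)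
  disjoint B hB C hC := hc.disjoint B (mem_of_mem_erase hB) C (mem_of_mem_erase hC)
  adj B hB C hC := hc.adj B (mem_of_mem_erase hB) C (mem_of_mem_erase hC)
  disjoint_left B hB := disjoint_union_right.mpr ⟨hc.disjoint_left B (mem_of_mem_erase hB),
    hc.disjoint B (mem_of_mem_erase hB) A hA (ne_of_mem_erase hB)⟩
  not_adj u hu v hv := by
    have hv' : v ∈ remaining S X M := by
      simp only [mem_remaining, mem_union, not_or, mem_erase, ne_eq, and_imp] at hv ⊢
      refine ⟨hv.1.1, hv.2.1, fun B hB => ?_⟩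
      by_cases hBA : B = A
      · exact hBA ▸ hv.1.2
      · exact hv.2.2 B hBA hB
    rcases mem_union.mp hu with hu | hu
    exacts [hc.not_adj u hu v hv', hno u hu v hv']

/-- A part of the remaining vertices can be cut off at the cost of its outer boundary. -/
lemma IsConfig.move_ball (hc : IsConfig G l m d S X M) {B L : Finset V} (hl : 0 ≤ l)
    (hB : B ⊆ remaining S X M) (hBL : l * #L ≤ #B)
    (hbd : ∀ u ∈ B, ∀ v ∈ remaining S X M, G.Adj u v → v ∈ B ∪ L) :
    IsConfig G l m d (S ∪ B) (X ∪ L) M where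
  card_sep := by
    have hdisj : Disjoint S B :=
      Finset.disjoint_right.mpr fun v hv => (mem_remaining.mp (hB hv)).1
    have h1 : (#(X ∪ L) : ℝ) ≤ #X + #L := by exact_mod_cast card_union_le X L
    have h2 := mul_le_mul_of_nonneg_left h1 hl
    have h3 := hc.card_sep
    rw [card_union_of_disjoint hdisj]
    push_cast
    linarith
  card_branch := hc.card_branch
  radius := hc.radius
  disjoint := hc.disjoint
  adj := hc.adj
  disjoint_left A hA := disjoint_union_right.mpr
    ⟨hc.disjoint_left A hA, (disjoint_remaining hA).mono_right hB⟩
  not_adj u hu v hv huv := by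
    have hv' := hv
    simp only [mem_remaining, mem_union, not_or] at hv'
    have hvW : v ∈ remaining S X M := mem_remaining.mpr ⟨hv'.1.1, hv'.2.1.1, hv'.2.2⟩
    rcases mem_union.mp hu with hu | hu
    · exact hc.not_adj u hu v hvW huv
    · rcases mem_union.mp (hbd u hu v hvW huv) with h | h
      exacts [hv'.1.2 h, hv'.2.1.2 h]

lemma IsConfig.insert_branch (hc : IsConfig G l m d S X M) {A : Finset V}
    (hA : A ⊆ remaining S X M) (hm : #A ≤ m)
    (hrad : ∃ x ∈ A, ∀ y ∈ A, ∃ p : G.Walk x y, p.length ≤ d ∧ ∀ z ∈ p.support, z ∈ A)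
    (hadj : ∀ B ∈ M, ∃ x ∈ B, ∃ y ∈ A, G.Adj x y) :
    IsConfig G l m d S X (insert A M) where
  card_sep := hc.card_sep
  card_branch := by simpa [hm] using hc.card_branch
  radius B hB := by
    rcases mem_insert.mp hB with rfl | hB
    exacts [hrad, hc.radius B hB]
  disjoint B hB C hC hne := by
    rcases mem_insert.mp hB with hBA | hBM <;> rcases mem_insert.mp hC with hCA | hCM
    · exact absurd (hBA.trans hCA.symm) hne
    · subst hBA
      exact ((disjoint_remaining hCM).mono_right hA).symm
    · subst hCA
      exact (disjoint_remaining hBM).mono_right hA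
    · exact hc.disjoint B hBM C hCM hne
  adj B hB C hC hne := by
    rcases mem_insert.mp hB with hBA | hBM <;> rcases mem_insert.mp hC with hCA | hCM
    · exact absurd (hBA.trans hCA.symm) hne
    · subst hBA
      obtain ⟨x, hx, y, hy, hxy⟩ := hadj C hCM
      exact ⟨y, hy, x, hx, hxy.symm⟩
    · subst hCA
      exact hadj B hBM
    · exact hc.adj B hBM C hCM hne
  disjoint_left B hB := by
    rcases mem_insert.mp hB with rfl | hB
    · exact Finset.disjoint_left.mpr fun v hv => (mem_remaining.mp (hA hv)).1
    · exact hc.disjoint_left B hB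
  not_adj u hu v hv := by
    refine hc.not_adj u hu v ?_
    simp only [mem_remaining, mem_insert, forall_eq_or_imp] at hv ⊢
    exact ⟨hv.1, hv.2.1, hv.2.2.2⟩

lemma IsConfig.isShallowMinor (hc : IsConfig G l m d S X M) :
    IsShallowMinor (⊤ : SimpleGraph (Fin #M)) G d := by
  have hne : ∀ i j, i ≠ j → (M.equivFin.symm i : Finset V) ≠ M.equivFin.symm j :=
    fun i j hij h => hij (M.equivFin.symm.injective (Subtype.ext h))
  refine ⟨fun i => ((M.equivFin.symm i : Finset V) : Set V), fun i j hij => ?_, fun i => ?_,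
    fun i j hij => ?_⟩
  · exact Finset.disjoint_coe.mpr
      (hc.disjoint _ (M.equivFin.symm i).2 _ (M.equivFin.symm j).2 (hne i j hij))
  · exact_mod_cast hc.radius _ (M.equivFin.symm i).2
  · exact_mod_cast hc.adj _ (M.equivFin.symm i).2 _ (M.equivFin.symm j).2 (hne i j hij)

/-- The step of the argument of Plotkin, Rao and Smith: a configuration with fewer than `h` branch
sets can be improved by enlarging `S`, or by adding a branch set. -/
lemma IsConfig.exists_improvement {h r : ℕ} (hl : 0 < l)
    (hr : (Fintype.card V : ℝ) < (1 + 1 / l) ^ r)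
    (hm : 3 * (h * (2 * r + 1)) ≤ Fintype.card V)
    (hc : IsConfig G l (h * (2 * r + 1)) (2 * r) S X M) (hM : #M < h)
    (hS : 3 * #S ≤ Fintype.card V) (hW : (remaining S X M).Nonempty) :
    ∃ S' X' M', IsConfig G l (h * (2 * r + 1)) (2 * r) S' X' M' ∧ #M' ≤ h ∧
      3 * #S' ≤ 2 * Fintype.card V ∧ (#S < #S' ∨ S' = S ∧ #M < #M') := by
  by_cases hno : ∃ A ∈ M, ∀ u ∈ A, ∀ v ∈ remaining S X M, ¬ G.Adj u v
  · obtain ⟨A, hA, hAno⟩ := hno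
    obtain ⟨x, hx, -⟩ := hc.radius A hA
    have hcard := card_union_of_disjoint (hc.disjoint_left A hA).symm
    have hpos : 0 < #A := card_pos.mpr ⟨x, hx⟩
    have hAm := hc.card_branch A hA
    exact ⟨_, _, _, hc.move_branch hA hAno, (card_le_card (erase_subset A M)).trans hM.le,
      by omega, .inl (by omega)⟩
  push Not at hno
  obtain ⟨x, hx⟩ := hW
  have : Nonempty V := ⟨x⟩
  choose! a ha f hf haf using hno
  by_cases hnear : ∀ A ∈ M, f A ∈ inducedBall G (remaining S X M) x (2 * r)
  · obtain ⟨A, hAW, hxA, hfA, hcard, hrad⟩ := exists_connected_set M f hx hnear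
    have hAM : A ∉ M := fun h =>
      Finset.disjoint_left.mp (disjoint_remaining (S := S) (X := X) h) hxA (hAW hxA)
    refine ⟨S, X, insert A M, hc.insert_branch hAW ?_ ⟨x, hxA, hrad⟩
      fun B hB => ⟨a B, ha B hB, f B, hfA B hB, haf B hB⟩, ?_, by omega, .inr ⟨rfl, ?_⟩⟩
    · calc #A ≤ #M * (2 * r + 1) + 1 := hcard
        _ ≤ (#M + 1) * (2 * r + 1) := by rw [Nat.add_one_mul #M]; omega
        _ ≤ h * (2 * r + 1) := Nat.mul_le_mul_right _ hM
    · rw [card_insert_of_notMem hAM]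
      exact hM
    · rw [card_insert_of_notMem hAM]
      exact Nat.lt_succ_self _
  push Not at hnear
  obtain ⟨A, hA, hfar⟩ := hnear
  -- The balls of radius `r` around `x` and `f A` are disjoint; take the smaller one.
  obtain ⟨y, hy, hhalf⟩ : ∃ y ∈ remaining S X M,
      2 * #(inducedBall G (remaining S X M) y r) ≤ #(remaining S X M) := by
    have hdisj : Disjoint (inducedBall G (remaining S X M) x r)
        (inducedBall G (remaining S X M) (f A) r) := by
      refine Finset.disjoint_left.mpr fun z hz hz' => hfar ?_
      rw [two_mul]
      exact mem_inducedBall_add hz (mem_inducedBall_comm.mp hz')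
    have hcard := card_le_card (union_subset (inducedBall_subset (G := G) (x := x) (r := r))
      (inducedBall_subset (G := G) (W := remaining S X M) (x := f A) (r := r)))
    rw [card_union_of_disjoint hdisj] at hcard
    rcases le_total #(inducedBall G (remaining S X M) x r)
      #(inducedBall G (remaining S X M) (f A) r) with hle | hle
    · exact ⟨x, hx, by omega⟩
    · exact ⟨f A, hf A hA, by omega⟩
  obtain ⟨s, hs, hthin⟩ := exists_thin_layer (G := G) hl hr hy
  have hSW : Disjoint S (remaining S X M) :=
    Finset.disjoint_right.mpr fun v hv => (mem_remaining.mp hv).1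
  have hsub := inducedBall_subset (G := G) (W := remaining S X M) (x := y) (r := s)
  have hpos : 0 < #(inducedBall G (remaining S X M) y s) :=
    card_pos.mpr ⟨y, self_mem_inducedBall hy⟩
  have hle := card_le_card (inducedBall_mono (G := G) (W := remaining S X M) (x := y) hs.le)
  have hcard := card_union_of_disjoint (hSW.mono_right hsub)
  have htot := card_le_univ (S ∪ remaining S X M)
  rw [card_union_of_disjoint hSW] at htot
  refine ⟨_, _, M, hc.move_ball hl.le hsub hthin fun u hu v hv huv => ?_, hM.le, by omega,
    .inl (by omega)⟩
  rw [union_sdiff_of_subset (inducedBall_mono (Nat.le_succ s))]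
  exact mem_inducedBall_succ hu hv huv

/-- Plotkin, Rao and Smith: a graph without small balanced separators has a shallow clique
minor. -/
theorem isShallowMinor_top_of_no_separator [Nonempty V] {h r : ℕ} {σ : ℝ} (hl : 0 < l)
    (hr : (Fintype.card V : ℝ) < (1 + 1 / l) ^ r)
    (hm : 3 * (h * (2 * r + 1)) ≤ Fintype.card V)
    (hσ : Fintype.card V / l + h * (h * (2 * r + 1)) ≤ σ)
    (hsep : ∀ A B : Finset V, (∀ u ∈ A, ∀ v ∈ B, ¬ G.Adj u v) → #(A ∪ B)ᶜ ≤ σ →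
      2 * Fintype.card V < 3 * #A ∨ 2 * Fintype.card V < 3 * #B) :
    IsShallowMinor (⊤ : SimpleGraph (Fin h)) G (2 * r) := by
  classical
  have hn : 0 < Fintype.card V := Fintype.card_pos
  -- A configuration whose left side has at most `2 n / 3` vertices has most vertices remaining.
  have hbig : ∀ S X M, IsConfig G l (h * (2 * r + 1)) (2 * r) S X M → #M ≤ h →
      3 * #S ≤ 2 * Fintype.card V → 2 * Fintype.card V < 3 * #(remaining S X M) := by
    intro S X M hc hM hS
    refine (hsep S _ hc.not_adj ?_).resolve_left (by omega)
    have h1 : (#(S ∪ remaining S X M)ᶜ : ℝ) ≤ #X + h * (h * (2 * r + 1)) := by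
      exact_mod_cast card_separator_le S X hM hc.card_branch
    have h2 : (#S : ℝ) ≤ Fintype.card V := by exact_mod_cast card_le_univ S
    have h3 : (#X : ℝ) ≤ Fintype.card V / l := by
      rw [le_div_iff₀' hl]
      exact hc.card_sep.trans h2
    linarith
  let T : Finset (Finset V × Finset V × Finset (Finset V)) :=
    {t | IsConfig G l (h * (2 * r + 1)) (2 * r) t.1 t.2.1 t.2.2 ∧ #t.2.2 ≤ h ∧
      3 * #t.1 ≤ Fintype.card V}
  -- The weight orders configurations lexicographically by the sizes of `S` and `M`.
  obtain ⟨⟨S, X, M⟩, ht, hmax⟩ := T.exists_max_image (fun t => (h + 1) * #t.1 + #t.2.2)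
    ⟨(∅, ∅, ∅), by simp [T, isConfig_empty]⟩
  simp only [T, mem_filter_univ] at ht
  obtain ⟨hc, hM, hS⟩ := ht
  rcases hM.eq_or_lt with hM | hM
  · exact hM ▸ hc.isShallowMinor
  have hW : (remaining S X M).Nonempty := by
    have := hbig S X M hc hM.le (by omega)
    exact card_pos.mp (by omega)
  obtain ⟨S', X', M', hc', hM', hS', himp⟩ := hc.exists_improvement hl hr hm hM hS hW
  have hW' := hbig S' X' M' hc' hM' hS'
  have hdisj : Disjoint S' (remaining S' X' M') :=
    Finset.disjoint_right.mpr fun v hv => (mem_remaining.mp hv).1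
  have htot := card_le_univ (S' ∪ remaining S' X' M')
  rw [card_union_of_disjoint hdisj] at htot
  have hle := hmax (S', X', M') (by simp only [T, mem_filter_univ]; exact ⟨hc', hM', by omega⟩)
  simp only at hle
  rcases himp with himp | ⟨rfl, himp⟩
  · have := Nat.mul_le_mul_left (h + 1) (Nat.succ_le_of_lt himp)
    rw [Nat.mul_succ] at this
    omega
  · omega

end Separator

/-! ### Choice of parameters -/

lemma isShallowMinor_top_one {V : Type*} [Nonempty V] (G : SimpleGraph V) :
    IsShallowMinor (⊤ : SimpleGraph (Fin 1)) G 0 := by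
  obtain ⟨v⟩ := ‹Nonempty V›
  refine ⟨fun _ => {v}, fun i j hij => absurd (Subsingleton.elim i j) hij, fun _ => ?_,
    fun i j hij => absurd (Subsingleton.elim i j) hij.ne⟩
  refine ⟨v, rfl, fun y hy => ?_⟩
  obtain rfl : y = v := hy
  exact ⟨.nil, by simp, by simp⟩

lemma lt_one_add_one_div_pow {n l : ℝ} {r : ℕ} (hn : 1 < n) (hl : 1 < l)
    (hr : 2 * l * Real.log n ≤ r) : n < (1 + 1 / l) ^ r := by
  have hlog : 0 < Real.log n := Real.log_pos hn
  have h1 : 1 / (l + 1) ≤ Real.log (1 + 1 / l) := by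
    have h := Real.one_sub_inv_le_log_of_pos (x := 1 + 1 / l) (by positivity)
    have h' : 1 - (1 + 1 / l)⁻¹ = 1 / (l + 1) := by
      field_simp
      ring
    rwa [h'] at h
  rw [← Real.log_lt_log_iff (by linarith) (by positivity), Real.log_pow]
  calc Real.log n < 2 * l * Real.log n * (1 / (l + 1)) := by
        rw [mul_one_div, lt_div_iff₀ (by linarith)]
        nlinarith
    _ ≤ r * Real.log (1 + 1 / l) := by gcongr

end WellMixing

open WellMixing Finset in
theorem mainTheorem5 :
    ∃ c C : ℝ, 0 < c ∧ 0 < C ∧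
      ∀ (ε δ : ℝ), 0 < ε → ε < 2 / 5 → 0 < δ → δ ≤ 1 / 30 →
      ∀ (n D τ : ℕ), 2 ≤ n →
      ∀ (Γ : SimpleGraph (Fin n)) [DecidableRel Γ.Adj], Γ.IsRegularOfDegree D →
        ε * (n : ℝ) ≤
          (({v : Fin n | WellMixing.tvDist (WellMixing.walkDist Γ τ v)
              (WellMixing.uniformDist (Fin n)) < δ}.ncard : ℕ) : ℝ) →
        ∃ h d : ℕ,
          c * (ε / (τ : ℝ)) * Real.sqrt ((n : ℝ) / Real.log (n : ℝ)) ≤ (h : ℝ) ∧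
          (d : ℝ) ≤ C * ((τ : ℝ) / ε) * Real.log (n : ℝ) ∧
          WellMixing.IsShallowMinor (⊤ : SimpleGraph (Fin h)) Γ d := by
  classical
  refine ⟨1 / 60, 80, by norm_num, by norm_num, ?_⟩
  intro ε δ hε hε' _ hδ n D τ hn Γ _ hΓ hmix
  have : Nonempty (Fin n) := ⟨⟨0, by omega⟩⟩
  have hn2 : (2 : ℝ) ≤ n := by exact_mod_cast hn
  have hn0 : (0 : ℝ) < n := by linarith
  have hlog : 1 / 2 < Real.log n := by
    have h1 := Real.log_two_gt_d9
    have h2 := Real.log_le_log (by norm_num) hn2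
    linarith
  set L := Real.log n with hL
  set x := 1 / 60 * (ε / (τ : ℝ)) * Real.sqrt ((n : ℝ) / L) with hx
  -- If the required order is at most `1`, a single vertex will do.  This covers `τ = 0`, where
  -- `ε / τ = 0`; otherwise `x > 1` makes `⌈x⌉₊ ≤ 2 * x` available.
  rcases le_or_gt x 1 with hx1 | hx1
  · exact ⟨1, 0, by simpa using hx1, by simp; positivity, isShallowMinor_top_one Γ⟩
  have hτ : τ ≠ 0 := by
    rintro rfl
    norm_num [hx] at hx1
  have hτ1 : (1 : ℝ) ≤ τ := by exact_mod_cast Nat.one_le_iff_ne_zero.mpr hτ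
  obtain ⟨k, hk⟩ : ∃ k : ℝ, k = τ / ε := ⟨_, rfl⟩
  have hk2 : 5 / 2 < k := by
    rw [hk, lt_div_iff₀ hε]
    linarith
  have hk0 : 0 < k := by linarith
  have hεk : ε / τ = 1 / k := by rw [hk, one_div_div]
  have hxk : (60 * x * k) ^ 2 * L = n := by
    have : 60 * x * k = Real.sqrt (n / L) := by
      rw [hx, hεk]
      field_simp
    rw [this, Real.sq_sqrt (by positivity)]
    field_simp
  obtain ⟨r, hr⟩ : ∃ r : ℕ, r = ⌈2 * (10 * k) * L⌉₊ := ⟨_, rfl⟩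
  have hr1 : 2 * (10 * k) * L ≤ r := hr ▸ Nat.le_ceil _
  have hr2 : (r : ℝ) < 2 * (10 * k) * L + 1 := hr ▸ Nat.ceil_lt_add_one (by positivity)
  have hkL : 5 / 4 < k * L := by nlinarith
  have hx2 : (⌈x⌉₊ : ℝ) ≤ 2 * x := by
    have := Nat.ceil_lt_add_one (zero_le_one.trans hx1.le)
    linarith
  have hrk : 2 * (r : ℝ) + 1 ≤ 80 * (k * L) := by linarith
  have hm : (⌈x⌉₊ : ℝ) * (⌈x⌉₊ * (2 * r + 1)) ≤ n / (10 * k) := by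
    calc (⌈x⌉₊ : ℝ) * (⌈x⌉₊ * (2 * r + 1)) ≤ (2 * x) * ((2 * x) * (80 * (k * L))) := by gcongr
      _ = (60 * x * k) ^ 2 * L * (8 / (90 * k)) := by
        field_simp
        ring
      _ ≤ n / (10 * k) := by
        rw [hxk, div_eq_mul_one_div (n : ℝ)]
        gcongr ?_ * ?_
        rw [div_le_div_iff₀ (by positivity) (by positivity)]
        linarith
  have hceil : (1 : ℝ) ≤ ⌈x⌉₊ := hx1.le.trans (Nat.le_ceil x)
  refine ⟨⌈x⌉₊, 2 * r, Nat.le_ceil x, ?_, ?_⟩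
  · rw [← hk]
    push_cast
    linarith
  refine isShallowMinor_top_of_no_separator (l := 10 * k) (σ := n / (5 * k)) (by positivity)
    ?_ ?_ ?_ ?_
  · simpa using lt_one_add_one_div_pow (by linarith) (by linarith) hr1
  · have h1 : (⌈x⌉₊ * (2 * r + 1) : ℝ) ≤ n / (10 * k) :=
      (le_mul_of_one_le_left (by positivity) hceil).trans hm
    have h2 : (n : ℝ) / (10 * k) ≤ n / 3 := by
      gcongr
      linarith
    have h3 : (3 * (⌈x⌉₊ * (2 * r + 1)) : ℝ) ≤ n := by linarith
    simpa using (by exact_mod_cast h3 : 3 * (⌈x⌉₊ * (2 * r + 1)) ≤ n)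
  · have : (n : ℝ) / (5 * k) = n / (10 * k) + n / (10 * k) := by
      field_simp
      norm_num
    rw [this, Fintype.card_fin]
    gcongr
  · intro A B hAB hZ
    refine not_balanced_of_mixing hε hτ hΓ
      {v | tvDist (walkDist Γ τ v) (uniformDist (Fin n)) < δ} ?_ ?_ A B hAB ?_
    · rw [← Set.ncard_coe_finset]
      simpa using hmix
    · intro v hv
      exact (mem_filter.mp hv).2.trans_le hδ
    · rw [le_div_iff₀ (by positivity), hk] at hZ
      rw [Fintype.card_fin]
      calc 5 * τ * (#(A ∪ B)ᶜ : ℝ) = #(A ∪ B)ᶜ * (5 * (τ / ε)) * ε := by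
            field_simp
        _ ≤ n * ε := by gcongr
        _ = ε * n := mul_comm _ _
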